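/- A permutation of length $n$ is a sequence containing each of $1,\dots,n$ exactly once. The standardization of a sequence of $n$ distinct integers is the unique permutation of length $n$ whose entries are in the same relative order. A permutation $\pi$ of length $l$ occurs in a permutation $\sigma$ of length $n$ at position $i$ ($1\le i\le n-l+1$) if $\sigma(i)\cdots\sigma(i+l-1)$ has standardization $\pi$. We say that $\pi$ divides $\sigma$ if it occurs in $\sigma$ at some position, and that $\sigma$ avoids $\pi$ otherwise. A finite set of permutations (a collection of patterns) is called reduced if none of its members divides another one. Two collections $\Pi_1,\Pi_2$ are strongly c-Wilf equivalent if for all integers $n\ge 1$ and $0\le q<n$ the number of permutations of length $n$ with exactly $q$ occurrences (at all positions together) of patterns from $\Pi_1$ equals the number of permutations of length $n$ with exactly $q$ occurrences of patterns from $\Pi_2$. Let $k,k'\ge 1$. Permutations $\alpha\in S_k$, $\beta\in S_{k'}$ have the separation property if $\beta$ avoids $(\alpha(1),\dots,\alpha(k),k+1)$ and $\alpha$ avoids $(k'+1,\beta(1),\dots,\beta(k'))$. For $l\ge 1$ let $\Pi(\alpha,\beta;l)\subset S_{k+l+k'}$ be the set of permutations $\pi$ whose first $k$ entries have standardization $\alpha$,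 whose last $k'$ entries have standardization $\beta$, and in which every one of the first $k$ entries is smaller than every one of the last $k'$ entries, and every one of the last $k'$ entries is smaller than every one of the $l$ middle entries $\pi(k+1),\dots,\pi(k+l)$. **Corollary 1.5.** Let $\alpha\in S_k$, $\beta\in S_{k'}$ have the separation property, and let $l_1,\dots,l_d\ge 1$ be integers. Then any two reduced collections $\{\pi_1,\dots,\pi_d\}$ and $\{\rho_1,\dots,\rho_d\}$, each consisting of $d$ distinct patterns with $\pi_i,\rho_i\in\Pi(\alpha,\beta;l_i)$ for all $i$, are strongly c-Wilf equivalent. Moreover, for every such reduced collection $\{\pi_1,\dots,\pi_d\}$ of $d$ distinct patterns, the middle entries never lie in overlapping sets: if $1\le i,j\le d$ and $m\ge 1$ does not exceed the lengths of $\pi_i$ and $\pi_j$, if the last $m$ entries of $\pi_i$ and the first $m$ entries of $\pi_j$ have the same standardization, and if it is not the case that both $i=j$ and $m=k+l_i+k'$, then none of the $l_i$ middle entries of $\pi_i$ is among its last $m$ entries, and none of the $l_j$ middle entries of $\pi_j$ is among its first $m$ entries. -/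

import Mathlib

/-!
Consecutive patterns in permutations. Permutations of length `n` are `Equiv.Perm (Fin n)`, so that
positions and entries are numbered from `0` to `n - 1`.
-/

namespace ConsecutivePattern

/-- A permutation of some length: `p.1` is the length of `p`, and `p.2` the permutation. -/
abbrev Pattern : Type := Σ n : ℕ, Equiv.Perm (Fin n)

/-- The factor of `σ` of length `l` that starts at position `i` exists, and its standardization
is `π`: its entries are in the same relative order as those of `π`. -/
def OccursAt {l n : ℕ} (π : Equiv.Perm (Fin l)) (σ : Equiv.Perm (Fin n)) (i : ℕ) : Prop :=
  ∃ h : i + l ≤ n, ∀ a b : Fin l,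
    σ ⟨i + a, by have := a.2; omega⟩ < σ ⟨i + b, by have := b.2; omega⟩ ↔ π a < π b

instance {l n : ℕ} (π : Equiv.Perm (Fin l)) (σ : Equiv.Perm (Fin n)) (i : ℕ) :
    Decidable (OccursAt π σ i) := by
  unfold OccursAt
  infer_instance

/-- `π` divides `σ`: the permutation `σ` contains `π` as a consecutive pattern. -/
def Divides {l n : ℕ} (π : Equiv.Perm (Fin l)) (σ : Equiv.Perm (Fin n)) : Prop :=
  ∃ i : ℕ, OccursAt π σ i

/-- `σ` avoids `π` as a consecutive pattern. -/
def Avoids {n l : ℕ} (σ : Equiv.Perm (Fin n)) (π : Equiv.Perm (Fin l)) : Prop :=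
  ¬ Divides π σ

/-- No pattern of the collection divides another one. -/
def IsReduced (C : Finset Pattern) : Prop :=
  ∀ p ∈ C, ∀ p' ∈ C, p ≠ p' → ¬ Divides p.2 p'.2

/-- The number of occurrences in `σ` of patterns from the collection `C`. -/
def occurrences (C : Finset Pattern) {n : ℕ} (σ : Equiv.Perm (Fin n)) : ℕ :=
  ∑ p ∈ C, ((Finset.range (n + 1)).filter fun i => OccursAt p.2 σ i).card

/-- The number of permutations of length `n` with exactly `q` occurrences of patterns from `C`. -/
def numWithOccurrences (C : Finset Pattern) (n q : ℕ) : ℕ :=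
  (Finset.univ.filter fun σ : Equiv.Perm (Fin n) => occurrences C σ = q).card

/-- Strong c-Wilf equivalence of collections of patterns. -/
def StronglyCWilfEquivalent (C₁ C₂ : Finset Pattern) : Prop :=
  ∀ n : ℕ, 0 < n → ∀ q : ℕ, q < n → numWithOccurrences C₁ n q = numWithOccurrences C₂ n q

/-- The permutation `(α(1), …, α(k), k + 1)`. -/
def appendMax {k : ℕ} (α : Equiv.Perm (Fin k)) : Equiv.Perm (Fin (k + 1)) :=
  (finSuccEquivLast.trans (Equiv.optionCongr α)).trans finSuccEquivLast.symm

theorem appendMax_castSucc {k : ℕ} (α : Equiv.Perm (Fin k)) (i : Fin k) :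
    appendMax α i.castSucc = (α i).castSucc := by
  simp [appendMax]

theorem appendMax_last {k : ℕ} (α : Equiv.Perm (Fin k)) :
    appendMax α (Fin.last k) = Fin.last k := by
  simp [appendMax]

/-- The permutation `(k + 1, β(1), …, β(k))`. -/
def prependMax {k : ℕ} (β : Equiv.Perm (Fin k)) : Equiv.Perm (Fin (k + 1)) :=
  ((finSuccEquiv k).trans (Equiv.optionCongr β)).trans finSuccEquivLast.symm

theorem prependMax_zero {k : ℕ} (β : Equiv.Perm (Fin k)) :
    prependMax β 0 = Fin.last k := by
  simp [prependMax]

theorem prependMax_succ {k : ℕ} (β : Equiv.Perm (Fin k)) (i : Fin k) :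
    prependMax β i.succ = (β i).castSucc := by
  simp [prependMax]

/-- The separation property of a pair of permutations. -/
def SeparationProperty {k k' : ℕ} (α : Equiv.Perm (Fin k)) (β : Equiv.Perm (Fin k')) : Prop :=
  Avoids β (appendMax α) ∧ Avoids α (prependMax β)

/-- The set `Π(α, β; l)`: the first `k` entries standardize to `α`, the last `k'` entries to `β`,
the first `k` entries are smaller than the last `k'` ones, and these are smaller than the `l`
entries in the middle. -/
def patternClass {k k' : ℕ} (α : Equiv.Perm (Fin k)) (β : Equiv.Perm (Fin k')) (l : ℕ) :
    Set (Equiv.Perm (Fin (k + l + k'))) :=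
  {π | OccursAt α π 0 ∧ OccursAt β π (k + l) ∧
    (∀ i j : Fin (k + l + k'), (i : ℕ) < k → k + l ≤ (j : ℕ) → π i < π j) ∧
    (∀ j s : Fin (k + l + k'), k + l ≤ (j : ℕ) → k ≤ (s : ℕ) → (s : ℕ) < k + l → π j < π s)}

/-- The collection `{π₁, …, π_d}` of the members of a finite family of permutations. -/
def collection {d : ℕ} {len : Fin d → ℕ} (π : (i : Fin d) → Equiv.Perm (Fin (len i))) :
    Finset Pattern :=
  Finset.univ.image fun i => (⟨len i, π i⟩ : Pattern)

/-- The patterns `π₁, …, π_d` are pairwise distinct. -/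
def AreDistinct {d : ℕ} {len : Fin d → ℕ} (π : (i : Fin d) → Equiv.Perm (Fin (len i))) : Prop :=
  Function.Injective fun i => (⟨len i, π i⟩ : Pattern)

/-- The pair `(π, π')` has an `m`-overlapping: the last `m` entries of `π` and the first `m`
entries of `π'` have the same standardization. -/
def Overlaps {n n' : ℕ} (π : Equiv.Perm (Fin n)) (π' : Equiv.Perm (Fin n')) (m : ℕ) : Prop :=
  0 < m ∧ ∃ (h : m ≤ n) (h' : m ≤ n'), ∀ a b : Fin m,
    π ⟨n - m + a, by have := a.2; omega⟩ < π ⟨n - m + b, by have := b.2; omega⟩ ↔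
      π' ⟨a, by have := a.2; omega⟩ < π' ⟨b, by have := b.2; omega⟩

/-- The set of the first `m` entries of `π`. -/
def firstEntries {n : ℕ} (π : Equiv.Perm (Fin n)) (m : ℕ) : Set (Fin n) :=
  π '' {i | (i : ℕ) < m}

/-- The set of the last `m` entries of `π`. -/
def lastEntries {n : ℕ} (π : Equiv.Perm (Fin n)) (m : ℕ) : Set (Fin n) :=
  π '' {i | n - m ≤ (i : ℕ)}

/-- The set of the `l` entries of `π` that follow the first `k` ones. -/
def middleEntries {n : ℕ} (π : Equiv.Perm (Fin n)) (k l : ℕ) : Set (Fin n) :=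
  π '' {i | k ≤ (i : ℕ) ∧ (i : ℕ) < k + l}

end ConsecutivePattern

namespace ConsecutivePattern

open Polynomial

/-! The separation property forbids proper overlaps longer than `k` or `k'`
(`Overlaps.le_of_mem_patternClass`), and reducedness forbids containment, so distinct occurrences in
one permutation share only outer positions (`OccursAt.separated`). Members of one class agree at
their outer positions (`eq_of_mem_patternClass`). Hence, for a prescribed set `S` of occurrences,
permuting positions inside the middle parts turns each `π i` into `ρ i` without disturbing the rest
of `S`, and this rearrangement depends only on `S`.

Occurrences outside `S` may appear or vanish, so this compares only "at least `S`" counts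
(`card_withOccurrencesAt_le`, in both directions). Inclusion–exclusion turns these into exact
counts. -/

theorem occursAt_iff {l n : ℕ} {π : Equiv.Perm (Fin l)} {σ : Equiv.Perm (Fin n)} {i : ℕ} :
    OccursAt π σ i ↔ i + l ≤ n ∧ ∀ (a b : Fin l) (x y : Fin n), (x : ℕ) = i + a →
      (y : ℕ) = i + b → (σ x < σ y ↔ π a < π b) := by
  constructor
  · rintro ⟨h, H⟩
    refine ⟨h, fun a b x y hx hy => ?_⟩
    rw [← H a b]
    obtain ⟨x, _⟩ := x
    obtain ⟨y, _⟩ := y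
    simp only at hx hy
    subst hx hy
    rfl
  · rintro ⟨h, H⟩
    exact ⟨h, fun a b => H a b _ _ rfl rfl⟩

theorem overlaps_iff {n n' : ℕ} {π : Equiv.Perm (Fin n)} {π' : Equiv.Perm (Fin n')} {m : ℕ} :
    Overlaps π π' m ↔ 0 < m ∧ m ≤ n ∧ m ≤ n' ∧ ∀ (x y : Fin n) (x' y' : Fin n'),
      (x : ℕ) = n - m + x' → (y : ℕ) = n - m + y' → (x' : ℕ) < m → (y' : ℕ) < m →
      (π x < π y ↔ π' x' < π' y') := by
  constructor
  · rintro ⟨h0, h, h', H⟩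
    refine ⟨h0, h, h', fun x y x' y' hx hy hx' hy' => ?_⟩
    obtain ⟨x, _⟩ := x
    obtain ⟨y, _⟩ := y
    simp only at hx hy
    subst hx hy
    exact H ⟨x', hx'⟩ ⟨y', hy'⟩
  · rintro ⟨h0, h, h', H⟩
    exact ⟨h0, h, h', fun a b => H _ _ _ _ rfl rfl a.2 b.2⟩

/-! ### Overlaps and rigidity of the outer entries -/

section PatternClass

variable {k k' : ℕ} {α : Equiv.Perm (Fin k)} {β : Equiv.Perm (Fin k')}

theorem lt_of_mem_patternClass (hk' : 0 < k') {l : ℕ} {π : Equiv.Perm (Fin (k + l + k'))}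
    (hπ : π ∈ patternClass α β l) (a b : Fin (k + l + k')) (ha : (a : ℕ) < k)
    (hb : k ≤ (b : ℕ)) : π a < π b := by
  obtain ⟨-, -, h1, h2⟩ := hπ
  by_cases h : (b : ℕ) < k + l
  · exact (h1 a ⟨k + l, by omega⟩ ha le_rfl).trans (h2 _ b le_rfl hb h)
  · exact h1 a b ha (by omega)

theorem Overlaps.le_of_mem_patternClass (hk : 0 < k) (hk' : 0 < k')
    (hsep : SeparationProperty α β) {l l' m : ℕ} (hl : 0 < l) (hl' : 0 < l')
    {π : Equiv.Perm (Fin (k + l + k'))} {π' : Equiv.Perm (Fin (k + l' + k'))}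
    (hπ : π ∈ patternClass α β l) (hπ' : π' ∈ patternClass α β l')
    (hm : m ≠ k + l + k') (h : Overlaps π π' m) : m ≤ k ∧ m ≤ k' := by
  obtain ⟨h0, hn, hn', H⟩ := overlaps_iff.1 h
  have low' := lt_of_mem_patternClass hk' hπ'
  by_contra hcon
  by_cases c1 : m ≤ k'
  · have c2 : k < m := by omega
    -- The overlap lies in the `β` part of `π`, while the first `k + 1` entries of `π'` are a copy
    -- of `α` followed by a larger middle entry.
    refine hsep.1 ⟨k' - m, occursAt_iff.2 ⟨by omega, ?_⟩⟩
    intro a b x y hx hy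
    obtain ⟨-, hβ⟩ := occursAt_iff.1 hπ.2.1
    rw [← hβ x y ⟨k + l + x, by omega⟩ ⟨k + l + y, by omega⟩ rfl rfl]
    rw [H _ _ ⟨a, by omega⟩ ⟨b, by omega⟩ (by simp only; omega) (by simp only; omega)
      (by simp only; omega) (by simp only; omega)]
    obtain ⟨-, hα⟩ := occursAt_iff.1 hπ'.1
    induction a using Fin.lastCases with
    | last =>
      induction b using Fin.lastCases with
      | last => simp
      | cast b =>
        rw [appendMax_last, appendMax_castSucc]
        exact iff_of_false (not_lt.2 (low' _ _ b.2 (by simp)).le)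
          (not_lt.2 (Fin.le_last _))
    | cast a =>
      induction b using Fin.lastCases with
      | last =>
        rw [appendMax_last, appendMax_castSucc]
        exact iff_of_true (low' _ _ a.2 (by simp)) (Fin.castSucc_lt_last _)
      | cast b =>
        rw [appendMax_castSucc, appendMax_castSucc, Fin.castSucc_lt_castSucc_iff]
        exact hα a b _ _ (by simp) (by simp)
  · by_cases c2 : m ≤ k
    -- Mirror case: the last `k' + 1` entries of `π`, a middle entry above a copy of `β`, fall in
    -- the `α` part of `π'`.
    · refine hsep.2 ⟨m - k' - 1, occursAt_iff.2 ⟨by omega, ?_⟩⟩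
      intro a b x y hx hy
      obtain ⟨-, hα⟩ := occursAt_iff.1 hπ'.1
      rw [← hα x y ⟨x, by omega⟩ ⟨y, by omega⟩ (by simp) (by simp)]
      rw [← H ⟨k + l - 1 + a, by omega⟩ ⟨k + l - 1 + b, by omega⟩ _ _ (by simp only; omega)
        (by simp only; omega) (by simp only; omega) (by simp only; omega)]
      obtain ⟨-, hβ⟩ := occursAt_iff.1 hπ.2.1
      have high := hπ.2.2.2
      induction a using Fin.cases with
      | zero =>
        induction b using Fin.cases with
        | zero => simp
        | succ b =>
          rw [prependMax_zero, prependMax_succ]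
          refine iff_of_false (not_lt.2 (high _ _ ?_ ?_ ?_).le) (not_lt.2 (Fin.le_last _)) <;>
            simp only [Fin.val_succ, Fin.val_zero] <;> omega
      | succ a =>
        induction b using Fin.cases with
        | zero =>
          rw [prependMax_zero, prependMax_succ]
          refine iff_of_true (high _ _ ?_ ?_ ?_) (Fin.castSucc_lt_last _) <;>
            simp only [Fin.val_succ, Fin.val_zero] <;> omega
        | succ b =>
          rw [prependMax_succ, prependMax_succ, Fin.castSucc_lt_castSucc_iff]
          refine hβ a b _ _ ?_ ?_ <;> simp only [Fin.val_succ] <;> omega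
    -- With shift `s > 0`, position `k - s` (truncated) of `π'` is in its low part but lies over
    -- position `max k s` of `π`, a middle one. Comparing it with the last entry of `π` gives
    -- opposite orders.
    · obtain ⟨s, hs⟩ : ∃ s, s = k + l + k' - m := ⟨_, rfl⟩
      have e1 := low' ⟨k - s, by omega⟩ ⟨m - 1, by omega⟩ (by simp only; omega)
        (by simp only; omega)
      rw [← H ⟨k + l + k' - m + (k - s), by omega⟩ ⟨k + l + k' - m + (m - 1), by omega⟩ _ _ rfl rfl
        (by simp only; omega) (by simp only; omega)] at e1
      exact lt_asymm e1 (hπ.2.2.2 _ _ (by simp only; omega) (by simp only; omega)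
        (by simp only; omega))

theorem card_filter_lt {n : ℕ} (π : Equiv.Perm (Fin n)) (v : Fin n) :
    (Finset.univ.filter fun b => π b < v).card = v := by
  rw [← Fin.card_Iio v]
  refine Finset.card_bij (fun b _ => π b) (by simp) (fun _ _ _ _ h => π.injective h) ?_
  intro b hb
  exact ⟨π.symm b, by simpa using hb, by simp⟩

/-- An entry is the number of smaller entries, and the class conditions decide every comparison with
an outer entry. -/
theorem eq_of_mem_patternClass (hk' : 0 < k') {l : ℕ} {π ρ : Equiv.Perm (Fin (k + l + k'))}
    (hπ : π ∈ patternClass α β l) (hρ : ρ ∈ patternClass α β l) (a : Fin (k + l + k'))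
    (ha : (a : ℕ) < k ∨ k + l ≤ (a : ℕ)) : π a = ρ a := by
  have lowπ := lt_of_mem_patternClass hk' hπ
  have lowρ := lt_of_mem_patternClass hk' hρ
  have key : ∀ b, π b < π a ↔ ρ b < ρ a := by
    intro b
    rcases ha with ha | ha
    · by_cases hb : (b : ℕ) < k
      · rw [(occursAt_iff.1 hπ.1).2 ⟨b, hb⟩ ⟨a, ha⟩ b a (by simp) (by simp),
          (occursAt_iff.1 hρ.1).2 ⟨b, hb⟩ ⟨a, ha⟩ b a (by simp) (by simp)]
      · exact iff_of_false (not_lt.2 (lowπ a b ha (by omega)).le)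
          (not_lt.2 (lowρ a b ha (by omega)).le)
    · by_cases hb : (b : ℕ) < k
      · exact iff_of_true (lowπ b a hb (by omega)) (lowρ b a hb (by omega))
      · by_cases hb' : (b : ℕ) < k + l
        · exact iff_of_false (not_lt.2 (hπ.2.2.2 a b ha (by omega) hb').le)
            (not_lt.2 (hρ.2.2.2 a b ha (by omega) hb').le)
        · have hb2 : (b : ℕ) - (k + l) < k' := by omega
          have ha2 : (a : ℕ) - (k + l) < k' := by omega
          rw [(occursAt_iff.1 hπ.2.1).2 ⟨_, hb2⟩ ⟨_, ha2⟩ b a (by simp only; omega)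
              (by simp only; omega),
            (occursAt_iff.1 hρ.2.1).2 ⟨_, hb2⟩ ⟨_, ha2⟩ b a (by simp only; omega)
              (by simp only; omega)]
  apply Fin.ext
  rw [← card_filter_lt π (π a), ← card_filter_lt ρ (ρ a)]
  simp only [key]

end PatternClass

/-! ### Rearranging positions inside windows -/

/-- A permutation of a window of positions extends to all positions. -/
theorem exists_perm_of_window {N n : ℕ} (t : Equiv.Perm (Fin N)) (p : ℕ) (h : p + N ≤ n) :
    ∃ T : Equiv.Perm (Fin n),
      (∀ (x : Fin n) (a : Fin N), (x : ℕ) = p + a → (T x : ℕ) = p + t a) ∧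
      ∀ x : Fin n, (∀ a : Fin N, (x : ℕ) = p + a → t a = a) → T x = x := by
  let f : Fin N ↪ Fin n := ⟨fun a => ⟨p + a, by omega⟩, fun a b hab => by
    simp only [Fin.mk.injEq] at hab; exact Fin.ext (by omega)⟩
  have h1 : ∀ (x : Fin n) (a : Fin N), (x : ℕ) = p + a →
      (t.viaFintypeEmbedding f x : ℕ) = p + t a := by
    intro x a hx
    have : x = f a := Fin.ext hx
    rw [this, Equiv.Perm.viaFintypeEmbedding_apply_image]
    rfl
  refine ⟨t.viaFintypeEmbedding f, h1, fun x hx => ?_⟩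
  by_cases hr : x ∈ Set.range f
  · obtain ⟨a, rfl⟩ := hr
    apply Fin.ext
    rw [h1 _ a rfl, hx a rfl]
    rfl
  · exact Equiv.Perm.viaFintypeEmbedding_apply_notMem_range _ _ hr

/-- Permutations of windows that fix the positions outside the middle parts can be performed
simultaneously if no middle part meets another window. -/
theorem exists_perm_of_windows {ι : Type*} [DecidableEq ι] {k k' n : ℕ} {l p : ι → ℕ}
    (t : (e : ι) → Equiv.Perm (Fin (k + l e + k')))
    (ht : ∀ e (a : Fin (k + l e + k')), (a : ℕ) < k ∨ k + l e ≤ (a : ℕ) → t e a = a) (S : Finset ι)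
    (hn : ∀ e ∈ S, p e + (k + l e + k') ≤ n)
    (hS : ∀ e ∈ S, ∀ f ∈ S, e ≠ f → ∀ x, p e + k ≤ x → x < p e + k + l e →
      x < p f ∨ p f + (k + l f + k') ≤ x) :
    ∃ T : Equiv.Perm (Fin n),
      (∀ e ∈ S, ∀ (x : Fin n) (a : Fin (k + l e + k')),
        (x : ℕ) = p e + a → (T x : ℕ) = p e + t e a) ∧
      ∀ x : Fin n, (∀ e ∈ S, (x : ℕ) < p e + k ∨ p e + k + l e ≤ x) → T x = x := by
  induction S using Finset.induction_on with
  | empty => exact ⟨1, by simp, by simp⟩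
  | insert e A he ih =>
    obtain ⟨T, hT1, hT2⟩ := ih (fun f hf => hn f (Finset.mem_insert_of_mem hf))
      (fun f hf g hg => hS f (Finset.mem_insert_of_mem hf) g (Finset.mem_insert_of_mem hg))
    obtain ⟨R, hR1, hR2⟩ := exists_perm_of_window (t e) (p e) (hn e (Finset.mem_insert_self _ _))
    have hne : ∀ f ∈ A, f ≠ e := fun f hf h => he (h ▸ hf)
    have hR2' : ∀ x : Fin n, (x : ℕ) < p e + k ∨ p e + k + l e ≤ x → R x = x := fun x hx =>
      hR2 x fun a ha => ht e a (by omega)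
    -- `R` acts first. It preserves the window of `e`, where `T` is trivial; conversely, `R` is
    -- trivial on the windows of `A`.
    refine ⟨T * R, ?_, ?_⟩
    · intro f hf x a hx
      rw [Equiv.Perm.mul_apply]
      rcases Finset.mem_insert.1 hf with rfl | hf
      · have hRx := hR1 x a hx
        rw [hT2 (R x), hRx]
        intro g hg
        by_contra hcon
        have := hS g (Finset.mem_insert_of_mem hg) f (Finset.mem_insert_self _ _) (hne g hg) (R x)
          (by omega) (by omega)
        have := (t f a).2
        omega
      · rw [hR2' x, hT1 f hf x a hx]
        by_contra hcon
        have := hS e (Finset.mem_insert_self _ _) f (Finset.mem_insert_of_mem hf)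
          (hne f hf).symm x (by omega) (by omega)
        have := a.2
        omega
    · intro x hx
      rw [Equiv.Perm.mul_apply, hR2' x (hx e (Finset.mem_insert_self _ _)),
        hT2 x fun f hf => hx f (Finset.mem_insert_of_mem hf)]

/-! ### Occurrences of a reduced family -/

section Family

variable {k k' d : ℕ} {α : Equiv.Perm (Fin k)} {β : Equiv.Perm (Fin k')} {l : Fin d → ℕ}

theorem not_divides_of_ne {len : Fin d → ℕ} {π : (i : Fin d) → Equiv.Perm (Fin (len i))}
    (hdist : AreDistinct π) (hred : IsReduced (collection π)) {i j : Fin d} (h : i ≠ j) :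
    ¬ Divides (π i) (π j) :=
  hred ⟨_, π i⟩ (Finset.mem_image_of_mem _ (Finset.mem_univ i)) ⟨_, π j⟩
    (Finset.mem_image_of_mem _ (Finset.mem_univ j)) fun e => h (hdist e)

theorem overlap_le (hk : 0 < k) (hk' : 0 < k') (hsep : SeparationProperty α β)
    (hl : ∀ i, 0 < l i) {π : (i : Fin d) → Equiv.Perm (Fin (k + l i + k'))}
    (hπ : ∀ i, π i ∈ patternClass α β (l i)) (hdist : AreDistinct π)
    (hred : IsReduced (collection π)) {i j : Fin d} {m : ℕ} (h : Overlaps (π i) (π j) m)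
    (hne : ¬ (i = j ∧ m = k + l i + k')) : m ≤ k ∧ m ≤ k' := by
  refine h.le_of_mem_patternClass hk hk' hsep (hl i) (hl j) (hπ i) (hπ j) fun hm => ?_
  -- If `m` were the full length of `π i`, then `π i` would be a prefix pattern of `π j`.
  refine not_divides_of_ne hdist hred (fun e => hne ⟨e, hm⟩) ⟨0, ?_⟩
  obtain ⟨h0, hn, hn', H⟩ := overlaps_iff.1 h
  refine occursAt_iff.2 ⟨by omega, fun a b x y hx hy => ?_⟩
  exact (H a b x y (by omega) (by omega) (by omega) (by omega)).symm

/-- Two occurrences in a permutation overlap at most in the outer parts of the patterns. -/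
theorem OccursAt.separated (hk : 0 < k) (hk' : 0 < k') (hsep : SeparationProperty α β)
    (hl : ∀ i, 0 < l i) {π : (i : Fin d) → Equiv.Perm (Fin (k + l i + k'))}
    (hπ : ∀ i, π i ∈ patternClass α β (l i)) (hdist : AreDistinct π)
    (hred : IsReduced (collection π)) {n : ℕ} {σ : Equiv.Perm (Fin n)} {i j : Fin d} {p q : ℕ}
    (hi : OccursAt (π i) σ p) (hj : OccursAt (π j) σ q) (hpq : p ≤ q) (hne : (i, p) ≠ (j, q)) :
    p + k + l i ≤ q ∧ p + (k + l i + k') ≤ q + k := by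
  obtain ⟨hpn, Hi⟩ := occursAt_iff.1 hi
  obtain ⟨hqn, Hj⟩ := occursAt_iff.1 hj
  by_cases hdisj : p + (k + l i + k') ≤ q
  · omega
  by_cases hnest : q + (k + l j + k') ≤ p + (k + l i + k')
  · exfalso
    have hij : j = i := by
      by_contra hij
      refine not_divides_of_ne hdist hred hij ⟨q - p, occursAt_iff.2 ⟨by omega, ?_⟩⟩
      intro a b x y hx hy
      rw [← Hi x y ⟨p + x, by omega⟩ ⟨p + y, by omega⟩ rfl rfl]
      exact Hj a b _ _ (by simp only; omega) (by simp only; omega)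
    subst hij
    exact hne (Prod.ext rfl (by simp only; omega))
  · have hov : Overlaps (π i) (π j) (p + (k + l i + k') - q) := by
      refine overlaps_iff.2 ⟨by omega, by omega, by omega, ?_⟩
      intro x y x' y' hx hy hx' hy'
      rw [← Hj x' y' ⟨q + x', by omega⟩ ⟨q + y', by omega⟩ rfl rfl]
      exact (Hi x y _ _ (by simp only; omega) (by simp only; omega)).symm
    have := overlap_le hk hk' hsep hl hπ hdist hred hov (by
      rintro ⟨rfl, hm⟩
      exact hne (Prod.ext rfl (by simp only; omega)))
    omega

/-- The permutations of length `n` with occurrences of the patterns of the family `π` at all the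
prescribed positions. -/
def withOccurrencesAt {len : Fin d → ℕ} (π : (i : Fin d) → Equiv.Perm (Fin (len i))) (n : ℕ)
    (S : Finset (Fin d × ℕ)) : Finset (Equiv.Perm (Fin n)) :=
  Finset.univ.filter fun σ => ∀ e ∈ S, OccursAt (π e.1) σ e.2

theorem card_withOccurrencesAt_le (hk : 0 < k) (hk' : 0 < k') (hsep : SeparationProperty α β)
    (hl : ∀ i, 0 < l i) {π ρ : (i : Fin d) → Equiv.Perm (Fin (k + l i + k'))}
    (hπ : ∀ i, π i ∈ patternClass α β (l i)) (hρ : ∀ i, ρ i ∈ patternClass α β (l i))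
    (hdist : AreDistinct π) (hred : IsReduced (collection π)) (n : ℕ)
    (S : Finset (Fin d × ℕ)) :
    (withOccurrencesAt π n S).card ≤ (withOccurrencesAt ρ n S).card := by
  rcases (withOccurrencesAt π n S).eq_empty_or_nonempty with h | ⟨σ₀, h₀⟩
  · simp [h]
  have h₀ : ∀ e ∈ S, OccursAt (π e.1) σ₀ e.2 := by simpa [withOccurrencesAt] using h₀
  -- `σ₀` serves only to show that the windows of `S` are compatible. At offset `a` of a window, `σ
  -- * T` reads `σ` at offset `π⁻¹ (ρ a)`, whose relative rank is `ρ a`.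
  obtain ⟨T, hT, -⟩ := exists_perm_of_windows (k := k) (k' := k') (n := n)
    (l := fun e : Fin d × ℕ => l e.1) (p := fun e => e.2)
    (fun e => (π e.1)⁻¹ * ρ e.1)
    (fun e a ha => by
      rw [Equiv.Perm.mul_apply, Equiv.Perm.inv_eq_iff_eq,
        eq_of_mem_patternClass hk' (hπ e.1) (hρ e.1) a ha]) S
    (fun e he => (occursAt_iff.1 (h₀ e he)).1) (by
      intro e he f hf hef x hx hx'
      rcases le_total e.2 f.2 with h | h
      · have := (h₀ e he).separated hk hk' hsep hl hπ hdist hred (h₀ f hf) h hef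
        omega
      · have := (h₀ f hf).separated hk hk' hsep hl hπ hdist hred (h₀ e he) h hef.symm
        omega)
  refine Finset.card_le_card_of_injOn (fun σ => σ * T) ?_ fun σ _ τ _ h => mul_right_cancel h
  intro σ hσ
  have hσ : ∀ e ∈ S, OccursAt (π e.1) σ e.2 := by simpa [withOccurrencesAt] using hσ
  suffices ∀ e ∈ S, OccursAt (ρ e.1) (σ * T) e.2 by simpa [withOccurrencesAt] using this
  intro e he
  obtain ⟨hn, H⟩ := occursAt_iff.1 (hσ e he)
  refine occursAt_iff.2 ⟨hn, fun a b x y hx hy => ?_⟩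
  rw [Equiv.Perm.mul_apply, Equiv.Perm.mul_apply,
    H _ _ _ _ (hT e he x a hx) (hT e he y b hy)]
  simp

/-! ### From prescribed occurrences to exact counts -/

theorem occurrences_collection {len : Fin d → ℕ} {π : (i : Fin d) → Equiv.Perm (Fin (len i))}
    (hdist : AreDistinct π) {n : ℕ} (σ : Equiv.Perm (Fin n)) :
    occurrences (collection π) σ =
      ((Finset.univ ×ˢ Finset.range (n + 1)).filter
        fun e : Fin d × ℕ => OccursAt (π e.1) σ e.2).card := by
  rw [occurrences, collection, Finset.sum_image fun i _ j _ h => hdist h, Finset.card_filter,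
    Finset.sum_product]
  simp only [Finset.card_filter]

/-- Inclusion and exclusion for the distribution of the number of occurrences. -/
theorem sum_X_pow_occurrences {len : Fin d → ℕ} {π : (i : Fin d) → Equiv.Perm (Fin (len i))}
    (hdist : AreDistinct π) (n : ℕ) :
    ∑ σ : Equiv.Perm (Fin n), (X : ℤ[X]) ^ occurrences (collection π) σ =
      ∑ S ∈ ((Finset.univ : Finset (Fin d)) ×ˢ Finset.range (n + 1)).powerset,
        ((withOccurrencesAt π n S).card : ℤ[X]) * (X - 1) ^ S.card := by
  have h : ∀ σ : Equiv.Perm (Fin n), (X : ℤ[X]) ^ occurrences (collection π) σ =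
      ∑ S ∈ ((Finset.univ : Finset (Fin d)) ×ˢ Finset.range (n + 1)).powerset,
        if ∀ e ∈ S, OccursAt (π e.1) σ e.2 then (X - 1) ^ S.card else 0 := by
    intro σ
    rw [← Finset.sum_filter, occurrences_collection hdist]
    -- Expanding `((X - 1) + 1) ^ occurrences` sums over the subsets of the actual occurrences.
    have h1 : (X : ℤ[X]) = (X - 1) + 1 := by ring
    conv_lhs => rw [h1]
    rw [← Finset.sum_pow_mul_eq_add_pow]
    simp only [one_pow, mul_one]
    refine Finset.sum_congr ?_ fun _ _ => rfl
    ext S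
    simp only [Finset.mem_powerset, Finset.mem_filter, Finset.subset_iff]
    exact ⟨fun h => ⟨fun e he => (h he).1, fun e he => (h he).2⟩,
      fun h e he => ⟨h.1 he, h.2 e he⟩⟩
  simp only [h]
  rw [Finset.sum_comm]
  refine Finset.sum_congr rfl fun S _ => ?_
  rw [← Finset.sum_filter, Finset.sum_const, nsmul_eq_mul, withOccurrencesAt]

theorem coeff_sum_X_pow_occurrences (C : Finset Pattern) (n q : ℕ) :
    (∑ σ : Equiv.Perm (Fin n), (X : ℤ[X]) ^ occurrences C σ).coeff q =
      numWithOccurrences C n q := by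
  simp [finsetSum_coeff, coeff_X_pow, numWithOccurrences, eq_comm]

end Family

end ConsecutivePattern

theorem corollary1p5 {k k' : ℕ} (hk : 0 < k) (hk' : 0 < k')
    (α : Equiv.Perm (Fin k)) (β : Equiv.Perm (Fin k'))
    (hsep : ConsecutivePattern.SeparationProperty α β)
    {d : ℕ} (l : Fin d → ℕ) (hl : ∀ i, 0 < l i) :
    (∀ π ρ : (i : Fin d) → Equiv.Perm (Fin (k + l i + k')),
      (∀ i, π i ∈ ConsecutivePattern.patternClass α β (l i)) →
      (∀ i, ρ i ∈ ConsecutivePattern.patternClass α β (l i)) →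
      ConsecutivePattern.AreDistinct π → ConsecutivePattern.AreDistinct ρ →
      ConsecutivePattern.IsReduced (ConsecutivePattern.collection π) →
      ConsecutivePattern.IsReduced (ConsecutivePattern.collection ρ) →
      ConsecutivePattern.StronglyCWilfEquivalent
        (ConsecutivePattern.collection π) (ConsecutivePattern.collection ρ)) ∧
    (∀ π : (i : Fin d) → Equiv.Perm (Fin (k + l i + k')),
      (∀ i, π i ∈ ConsecutivePattern.patternClass α β (l i)) →
      ConsecutivePattern.AreDistinct π →
      ConsecutivePattern.IsReduced (ConsecutivePattern.collection π) →
      ∀ (i j : Fin d) (m : ℕ), ConsecutivePattern.Overlaps (π i) (π j) m →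
        ¬ (i = j ∧ m = k + l i + k') →
        Disjoint (ConsecutivePattern.lastEntries (π i) m)
          (ConsecutivePattern.middleEntries (π i) k (l i)) ∧
        Disjoint (ConsecutivePattern.firstEntries (π j) m)
          (ConsecutivePattern.middleEntries (π j) k (l j))) := by
  refine ⟨fun π ρ hπ hρ hdπ hdρ hrπ hrρ n _ q _ => ?_, fun π hπ hd hr i j m hov hne => ?_⟩
  · have h : ∀ S, (ConsecutivePattern.withOccurrencesAt π n S).card =
        (ConsecutivePattern.withOccurrencesAt ρ n S).card := fun S => le_antisymm
      (ConsecutivePattern.card_withOccurrencesAt_le hk hk' hsep hl hπ hρ hdπ hrπ n S)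
      (ConsecutivePattern.card_withOccurrencesAt_le hk hk' hsep hl hρ hπ hdρ hrρ n S)
    apply Nat.cast_injective (R := ℤ)
    rw [← ConsecutivePattern.coeff_sum_X_pow_occurrences,
      ← ConsecutivePattern.coeff_sum_X_pow_occurrences,
      ConsecutivePattern.sum_X_pow_occurrences hdπ, ConsecutivePattern.sum_X_pow_occurrences hdρ]
    simp only [h]
  · have hm := ConsecutivePattern.overlap_le hk hk' hsep hl hπ hd hr hov hne
    constructor
    · refine (Set.disjoint_image_iff (π i).injective).2 (Set.disjoint_left.2 fun x hx hx' => ?_)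
      simp only [Set.mem_ofPred_eq] at hx hx'
      omega
    · refine (Set.disjoint_image_iff (π j).injective).2 (Set.disjoint_left.2 fun x hx hx' => ?_)
      simp only [Set.mem_ofPred_eq] at hx hx'
      omega
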